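/- **Corollary (Minimality of $\mathrm{QC}_{\mathrm{ugp}}$).** Consider the prop of vanilla quantum circuits up to global phases, generated by $H:1\to1$, $P(\varphi):1\to1$ (for every $\varphi\in\mathbb R$) and $\mathrm{CNot}:2\to2$ (control on the first wire), together with the empty circuit, the identity wire $I$ and the swap. Write $R_X(\theta):=H\circ P(\theta)\circ H$, and $\mathrm{NotC}:=\mathrm{Swap}\circ\mathrm{CNot}\circ\mathrm{Swap}$. Let $\Lambda^kP(\varphi):k+1\to k+1$ be the phase gate on the last wire controlled by the first $k$ wires, defined by $\Lambda^0P(\varphi):=P(\varphi)$ and, inductively, $\Lambda^{k+1}P(\varphi):=X\circ B_{-\varphi/2}\circ X\circ B_{\varphi/2}\circ A$, where, $c$ being the last control wire and $t$ the last wire, $X$ is the CNot with control $c$ and target $t$, $A$ is $\Lambda^kP(\varphi/2)$ with target $c$ and $B_{\psi}$ is $\Lambda^kP(\psi)$ with target $t$, both controlled by the first $k$ wires. Let $\mathrm{QC}_{\mathrm{ugp}}$ be the equational theory with the following axioms. * $(\mathrm H^2)$: $H\circ H=I$. * $(\mathrm P_0)$: $P(0)=I$. * $(\mathrm C)$: $\mathrm{CNot}\circ(P(\varphi)\otimes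 I)\circ\mathrm{CNot}=P(\varphi)\otimes I$, for all $\varphi\in\mathbb R$. * $(\mathrm B)$: $\mathrm{NotC}\circ\mathrm{CNot}=\mathrm{CNot}\circ\mathrm{Swap}$. * $(\mathrm{CZ})$: $(I\otimes H)\circ\mathrm{CNot}\circ(I\otimes H)=\mathrm{CNot}\circ(I\otimes P(-\tfrac\pi2))\circ\mathrm{CNot}\circ(P(\tfrac\pi2)\otimes P(\tfrac\pi2))$. * $(\mathrm E_{\mathrm H})$: $H=P(\tfrac\pi2)\circ R_X(\tfrac\pi2)\circ P(\tfrac\pi2)$. * $(\mathrm{Euler})$: $R_X(\alpha_3)\circ P(\alpha_2)\circ R_X(\alpha_1)=P(\beta_3)\circ R_X(\beta_2)\circ P(\beta_1)$, for all $\alpha_1,\alpha_2,\alpha_3\in\mathbb R$, where, with $z=\cos\frac{\alpha_2}2\cos\frac{\alpha_1+\alpha_3}2+i\sin\frac{\alpha_2}2\cos\frac{\alpha_1-\alpha_3}2$ and $z'=\cos\frac{\alpha_2}2\sin\frac{\alpha_1+\alpha_3}2-i\sin\frac{\alpha_2}2\sin\frac{\alpha_1-\alpha_3}2$, the angles $\beta_j\in[0,2\pi)$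 are, modulo $2\pi$: $(\beta_1,\beta_2,\beta_3)=(2\arg z,0,0)$ if $z'=0$; $(2\arg z',\pi,0)$ if $z=0$; and $(\arg z+\arg z',\,2\arg(i+|z/z'|),\,\arg z-\arg z')$ otherwise. * $(\mathrm I_c)$, one axiom for each number $c\ge2$ of controls: $\Lambda^{c}P(2\pi)=I^{\otimes(c+1)}$. An equation $C_1=C_2$ is derivable from a set $\Gamma$ of equations if $C_1$ can be transformed into $C_2$ using only the equations of $\Gamma$, in any context and in both directions, together with the laws of a prop. Then $\mathrm{QC}_{\mathrm{ugp}}$ is minimal: none of its axioms can be derived from the others. That is, for each of the axioms listed above, it is not the case that all its instances are derivable from the instances of all the other axioms. In particular, for each $c\ge2$, $(\mathrm I_c)$ is not derivable from the other axioms and all the $(\mathrm I_{c'})$ with $c'\ne c$. -/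

import Mathlib

namespace CircuitUGP

/-- Syntax of the prop of vanilla quantum circuits up to global phases: terms `n → m` built from
the gates `H`, `P φ`, `CNOT` and from the structure of a prop (empty circuit, identity wire, swap,
sequential and parallel composition). Terms are identified by the laws of a prop in `Derives`. -/
inductive Circuit : ℕ → ℕ → Type
  | H : Circuit 1 1
  | P (φ : ℝ) : Circuit 1 1
  | CNOT : Circuit 2 2
  | empty : Circuit 0 0
  | wire : Circuit 1 1
  | swap : Circuit 2 2
  | seq {n m k : ℕ} (C₁ : Circuit n m) (C₂ : Circuit m k) : Circuit n k
  | tensor {n₁ m₁ n₂ m₂ : ℕ} (C₁ : Circuit n₁ m₁) (C₂ : Circuit n₂ m₂) :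
      Circuit (n₁ + n₂) (m₁ + m₂)

/-- `C₁ ⨟ᶜ C₂` is `C₂ ∘ C₁`: first `C₁`, then `C₂` (left to right in a circuit diagram). -/
infixl:65 " ⨟ᶜ " => Circuit.seq

/-- `C₁ ⊗ᶜ C₂` is the parallel composition, `C₁` being drawn above `C₂`. -/
infixl:70 " ⊗ᶜ " => Circuit.tensor

namespace Circuit

/-- Transport of a circuit along equalities between numbers of wires. -/
def cast {n m n' m' : ℕ} (hn : n = n') (hm : m = m') (C : Circuit n m) : Circuit n' m' :=
  hn ▸ hm ▸ C

/-- The identity on `n` wires. -/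
def wires : (n : ℕ) → Circuit n n
  | 0 => empty
  | k + 1 => (wire ⊗ᶜ wires k).cast (Nat.add_comm 1 k) (Nat.add_comm 1 k)

/-- `σ_k`: the last of `k + 1` wires is moved above the other `k` wires;
`σ_0 = wire` and `σ_{k+1} = (swap ⊗ wires k) ∘ (wire ⊗ σ_k)`. -/
def sigma : (k : ℕ) → Circuit (k + 1) (1 + k)
  | 0 => wire
  | k + 1 =>
      ((wire ⊗ᶜ sigma k).cast (m' := 2 + k) (Nat.add_comm 1 (k + 1)) (by omega)
        ⨟ᶜ (swap ⊗ᶜ wires k)).cast rfl (by omega)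

/-- The gate `R_X(θ)` without its global phase. -/
def RX (θ : ℝ) : Circuit 1 1 := H ⨟ᶜ P θ ⨟ᶜ H

/-- The CNot gate whose control is the second wire and whose target is the first one. -/
def NOTC : Circuit 2 2 := swap ⨟ᶜ CNOT ⨟ᶜ swap

/-- A two-wire circuit applied to the last two of `k + 2` wires. -/
def onLastTwo (k : ℕ) (G : Circuit 2 2) : Circuit (k + 2) (k + 2) :=
  tensor (n₁ := k) (m₁ := k) (n₂ := 2) (m₂ := 2) (wires k) G

/-- A circuit applied to the first `k + 1` of `k + 2` wires. -/
def onAllButLast (k : ℕ) (G : Circuit (k + 1) (k + 1)) : Circuit (k + 2) (k + 2) :=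
  tensor (n₁ := k + 1) (m₁ := k + 1) (n₂ := 1) (m₂ := 1) G wire

/-- The gate `P φ` acting on the last of `k + 1` wires and controlled by the first `k` wires.
With one more control, call `c` the last control and `t` the target (the last two wires): apply
`P (φ / 2)` to `c` and then to `t`, then a CNot from `c` to `t`, then `P (-φ / 2)` to `t`, then
again the CNot, all phase gates being controlled by the first `k` wires only. -/
noncomputable def mctrlP : (k : ℕ) → ℝ → Circuit (k + 1) (k + 1)
  | 0, φ => P φ
  | k + 1, φ =>
      onAllButLast k (mctrlP k (φ / 2))
      ⨟ᶜ (onLastTwo k swap ⨟ᶜ onAllButLast k (mctrlP k (φ / 2)) ⨟ᶜ onLastTwo k swap)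
      ⨟ᶜ onLastTwo k CNOT
      ⨟ᶜ (onLastTwo k swap ⨟ᶜ onAllButLast k (mctrlP k (-(φ / 2))) ⨟ᶜ onLastTwo k swap)
      ⨟ᶜ onLastTwo k CNOT

end Circuit

open Circuit in
/-- `Derives Γ C₁ C₂`: the circuit `C₁` can be transformed into `C₂` using the equations in `Γ`
together with the laws of a prop. -/
inductive Derives (Γ : ∀ n m : ℕ, Circuit n m → Circuit n m → Prop) :
    ∀ {n m : ℕ}, Circuit n m → Circuit n m → Prop
  -- the equations of the theory, used in any context
  | ax {n m : ℕ} {C D : Circuit n m} : Γ n m C D → Derives Γ C D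
  | refl {n m : ℕ} (C : Circuit n m) : Derives Γ C C
  | symm {n m : ℕ} {C D : Circuit n m} : Derives Γ C D → Derives Γ D C
  | trans {n m : ℕ} {C D E : Circuit n m} : Derives Γ C D → Derives Γ D E → Derives Γ C E
  | seq_congr {n m k : ℕ} {C C' : Circuit n m} {D D' : Circuit m k} :
      Derives Γ C C' → Derives Γ D D' → Derives Γ (C ⨟ᶜ D) (C' ⨟ᶜ D')
  | tensor_congr {n m p q : ℕ} {C C' : Circuit n m} {D D' : Circuit p q} :
      Derives Γ C C' → Derives Γ D D' → Derives Γ (C ⊗ᶜ D) (C' ⊗ᶜ D')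
  -- the laws of a prop
  | seq_assoc {n m k l : ℕ} (C : Circuit n m) (D : Circuit m k) (E : Circuit k l) :
      Derives Γ ((C ⨟ᶜ D) ⨟ᶜ E) (C ⨟ᶜ (D ⨟ᶜ E))
  | tensor_assoc {n₁ m₁ n₂ m₂ n₃ m₃ : ℕ}
      (C : Circuit n₁ m₁) (D : Circuit n₂ m₂) (E : Circuit n₃ m₃) :
      Derives Γ (((C ⊗ᶜ D) ⊗ᶜ E).cast (Nat.add_assoc n₁ n₂ n₃) (Nat.add_assoc m₁ m₂ m₃))
        (C ⊗ᶜ (D ⊗ᶜ E))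
  | interchange {n m k n' m' k' : ℕ} (C₁ : Circuit n m) (C₂ : Circuit n' m')
      (C₃ : Circuit m k) (C₄ : Circuit m' k') :
      Derives Γ ((C₁ ⊗ᶜ C₂) ⨟ᶜ (C₃ ⊗ᶜ C₄)) ((C₁ ⨟ᶜ C₃) ⊗ᶜ (C₂ ⨟ᶜ C₄))
  | tensor_empty {n m : ℕ} (C : Circuit n m) :
      Derives Γ ((C ⊗ᶜ empty).cast (Nat.add_zero n) (Nat.add_zero m)) C
  | empty_tensor {n m : ℕ} (C : Circuit n m) :
      Derives Γ ((empty ⊗ᶜ C).cast (Nat.zero_add n) (Nat.zero_add m)) C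
  | wires_seq {n m : ℕ} (C : Circuit n m) : Derives Γ (wires n ⨟ᶜ C) C
  | seq_wires {n m : ℕ} (C : Circuit n m) : Derives Γ (C ⨟ᶜ wires m) C
  | swap_swap : Derives Γ (swap ⨟ᶜ swap) (wire ⊗ᶜ wire)
  | sigma_natural {n m : ℕ} (C : Circuit n m) :
      Derives Γ ((C ⊗ᶜ wire) ⨟ᶜ sigma m) (sigma n ⨟ᶜ (wire ⊗ᶜ C))

/-! ### The angles of the Euler equation -/

/-- Representative in `[0, 2π)` of a real number modulo `2π`. -/
noncomputable def mod2pi (x : ℝ) : ℝ := toIcoMod Real.two_pi_pos 0 x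

/-- `z = cos(α₂/2) cos((α₁+α₃)/2) + i sin(α₂/2) cos((α₁-α₃)/2)` -/
noncomputable def eulerZ (α₁ α₂ α₃ : ℝ) : ℂ :=
  ⟨Real.cos (α₂ / 2) * Real.cos ((α₁ + α₃) / 2), Real.sin (α₂ / 2) * Real.cos ((α₁ - α₃) / 2)⟩

/-- `z' = cos(α₂/2) sin((α₁+α₃)/2) - i sin(α₂/2) sin((α₁-α₃)/2)` -/
noncomputable def eulerZ' (α₁ α₂ α₃ : ℝ) : ℂ :=
  ⟨Real.cos (α₂ / 2) * Real.sin ((α₁ + α₃) / 2), -(Real.sin (α₂ / 2) * Real.sin ((α₁ - α₃) / 2))⟩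

open Classical in
noncomputable def eulerβ₁ (α₁ α₂ α₃ : ℝ) : ℝ :=
  if eulerZ' α₁ α₂ α₃ = 0 then mod2pi (2 * (eulerZ α₁ α₂ α₃).arg)
  else if eulerZ α₁ α₂ α₃ = 0 then mod2pi (2 * (eulerZ' α₁ α₂ α₃).arg)
  else mod2pi ((eulerZ α₁ α₂ α₃).arg + (eulerZ' α₁ α₂ α₃).arg)

open Classical in
noncomputable def eulerβ₂ (α₁ α₂ α₃ : ℝ) : ℝ :=
  if eulerZ' α₁ α₂ α₃ = 0 then 0
  else if eulerZ α₁ α₂ α₃ = 0 then Real.pi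
  else mod2pi (2 * (Complex.I + (‖eulerZ α₁ α₂ α₃ / eulerZ' α₁ α₂ α₃‖ : ℂ)).arg)

open Classical in
noncomputable def eulerβ₃ (α₁ α₂ α₃ : ℝ) : ℝ :=
  if eulerZ' α₁ α₂ α₃ = 0 then 0
  else if eulerZ α₁ α₂ α₃ = 0 then 0
  else mod2pi ((eulerZ α₁ α₂ α₃).arg - (eulerZ' α₁ α₂ α₃).arg)

/-! ### The equational theory -/

/-- Names of the axioms. The last axiom is one equation for each number `c ≥ 2` of controls. -/
inductive AxiomName : Type
  | HH
  | P0
  | C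
  | B
  | CZ
  | EH
  | Euler
  | I (c : ℕ) (hc : 2 ≤ c)

open Circuit in
/-- The theory `QC_ugp`: `QCugp a n m C D` says that `C = D` is (an instance of) the axiom `a`. -/
inductive QCugp : AxiomName → ∀ n m : ℕ, Circuit n m → Circuit n m → Prop
  | HH : QCugp .HH 1 1 (H ⨟ᶜ H) wire
  | P0 : QCugp .P0 1 1 (P 0) wire
  | C (φ : ℝ) : QCugp .C 2 2 (CNOT ⨟ᶜ (P φ ⊗ᶜ wire) ⨟ᶜ CNOT) (P φ ⊗ᶜ wire)
  | B : QCugp .B 2 2 (CNOT ⨟ᶜ NOTC) (swap ⨟ᶜ CNOT)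
  | CZ : QCugp .CZ 2 2 ((wire ⊗ᶜ H) ⨟ᶜ CNOT ⨟ᶜ (wire ⊗ᶜ H))
      ((P (Real.pi / 2) ⊗ᶜ P (Real.pi / 2)) ⨟ᶜ CNOT ⨟ᶜ (wire ⊗ᶜ P (-(Real.pi / 2))) ⨟ᶜ CNOT)
  | EH : QCugp .EH 1 1 H (P (Real.pi / 2) ⨟ᶜ RX (Real.pi / 2) ⨟ᶜ P (Real.pi / 2))
  | Euler (α₁ α₂ α₃ : ℝ) : QCugp .Euler 1 1 (RX α₁ ⨟ᶜ P α₂ ⨟ᶜ RX α₃)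
      (P (eulerβ₁ α₁ α₂ α₃) ⨟ᶜ RX (eulerβ₂ α₁ α₂ α₃) ⨟ᶜ P (eulerβ₃ α₁ α₂ α₃))
  | I (c : ℕ) (hc : 2 ≤ c) : QCugp (.I c hc) (c + 1) (c + 1)
      (mctrlP c (2 * Real.pi)) (wires (c + 1))

/-- A theory, given as a family of axioms each of which is a set of equations (its instances), is
minimal if no axiom can be derived from the others: for each axiom `a`, it is not the case that
all instances of `a` are derivable from the instances of the other axioms. -/
def IsMinimal {ι : Type} (Γ : ι → ∀ n m : ℕ, Circuit n m → Circuit n m → Prop) : Prop :=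
  ∀ a : ι, ¬ ∀ (n m : ℕ) (C D : Circuit n m), Γ a n m C D →
    Derives (fun n m C' D' => ∃ b : ι, b ≠ a ∧ Γ b n m C' D') C D

end CircuitUGP

namespace CircuitUGP

open Circuit

/-! For each axiom there is an invariant respected by the other axioms and violated by that one.
Every circuit has as many outputs as inputs, so a derivation between circuits on `n` wires only
rewrites subcircuits on at most `n` wires, and axioms on more wires can be ignored. For the seven
axioms on one or two wires, a product of integer weights of the generators suffices
(`not_derivable_of_weight`); no `I c` is narrow enough to interfere. For `I c`, each generator is
interpreted by its matrix rescaled to determinant `1`. On `n` wires, axioms then hold only up to a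
scalar, naturally a `2 ^ n`-th root of unity. The full turn `mctrlP c (2 * π)` becomes a scalar `κ`
with `κ ^ 2 ^ c = -1` (`exists_interp_mctrlP_two_pi`). Equality up to `2 ^ d n`-th roots of unity,
with `d n = n` except `d (c + 1) = c`, is preserved by derivations (`eqPhase_of_derives`): it admits
every `I c'` with `c' ≠ c`, but not `I c`. -/

theorem Circuit.wires_eq {n m : ℕ} (C : Circuit n m) : n = m := by
  induction C <;> omega

/-! ### Weights -/

/-- A multiplicative weight on the generators. -/
structure Weight where
  h : ℤ
  p : ℝ → ℤ
  cnot : ℤ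
  swap : ℤ

/-- The product of the weights of the generators of a circuit. -/
def Weight.eval (w : Weight) : ∀ {n m : ℕ}, Circuit n m → ℤ
  | _, _, .H => w.h
  | _, _, .P φ => w.p φ
  | _, _, .CNOT => w.cnot
  | _, _, .empty => 1
  | _, _, .wire => 1
  | _, _, .swap => w.swap
  | _, _, .seq C D => w.eval C * w.eval D
  | _, _, .tensor C D => w.eval C * w.eval D

namespace Weight

variable (w : Weight)

@[simp] theorem eval_cast {n m n' m' : ℕ} (hn : n = n') (hm : m = m') (C : Circuit n m) :
    w.eval (C.cast hn hm) = w.eval C := by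
  subst hn hm; rfl

@[simp] theorem eval_wires (n : ℕ) : w.eval (wires n) = 1 := by
  induction n with
  | zero => rfl
  | succ n ih => simp [wires, eval, ih]

/-- A weight which is compatible with the equations on at most `N` wires is invariant under
derivations between circuits on at most `N` wires. -/
theorem eval_eq_of_derives {N : ℕ} {Γ : ∀ n m : ℕ, Circuit n m → Circuit n m → Prop}
    (hs : 2 ≤ N → w.swap * w.swap = 1)
    (hΓ : ∀ n m C D, Γ n m C D → n ≤ N → w.eval C = w.eval D)
    {n m : ℕ} {C D : Circuit n m} (h : Derives Γ C D) : n ≤ N → w.eval C = w.eval D := by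
  induction h with
  | ax h => exact hΓ _ _ _ _ h
  | refl C => exact fun _ => rfl
  | symm _ ih => exact fun hn => (ih hn).symm
  | trans _ _ ih₁ ih₂ => exact fun hn => (ih₁ hn).trans (ih₂ hn)
  | @seq_congr n m k C C' D D' _ _ ih₁ ih₂ =>
    intro hn
    -- The intermediate width equals `n`, so the bound `N` also applies to the second factor.
    have := C.wires_eq
    simp only [eval]
    rw [ih₁ hn, ih₂ (by omega)]
  | tensor_congr _ _ ih₁ ih₂ =>
    intro hn
    simp only [eval]
    rw [ih₁ (by omega), ih₂ (by omega)]
  | swap_swap => exact fun hn => by simp [eval, hs hn]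
  | sigma_natural C =>
    obtain rfl := C.wires_eq
    exact fun _ => by simp [eval, mul_comm]
  | _ => exact fun _ => by simp [eval, mul_comm, mul_left_comm, mul_assoc]

end Weight

/-- An axiom violated by a weight which is compatible with the other equations on few wires. -/
theorem not_derivable_of_weight (w : Weight) (N : ℕ) (a : AxiomName)
    (hs : 2 ≤ N → w.swap * w.swap = 1)
    (hΓ : ∀ b, b ≠ a → ∀ n m C D, QCugp b n m C D → n ≤ N → w.eval C = w.eval D)
    (ha : ∃ n m C D, QCugp a n m C D ∧ n ≤ N ∧ w.eval C ≠ w.eval D) :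
    ¬ ∀ (n m : ℕ) (C D : Circuit n m), QCugp a n m C D →
      Derives (fun n m C' D' => ∃ b, b ≠ a ∧ QCugp b n m C' D') C D := by
  intro h
  obtain ⟨n, m, C, D, hCD, hn, hne⟩ := ha
  refine hne (w.eval_eq_of_derives hs ?_ (h n m C D hCD) hn)
  rintro n m C D ⟨b, hb, hCD⟩
  exact hΓ b hb n m C D hCD

/-! ### Weights separating the axioms on one or two wires -/

theorem mod2pi_lt (x : ℝ) : mod2pi x < 2 * Real.pi := by
  simpa [mod2pi] using toIcoMod_lt_right Real.two_pi_pos 0 x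

theorem eulerβ₁_lt (a b c : ℝ) : eulerβ₁ a b c < 2 * Real.pi := by
  unfold eulerβ₁; split_ifs <;> exact mod2pi_lt _

theorem eulerβ₂_lt (a b c : ℝ) : eulerβ₂ a b c < 2 * Real.pi := by
  have := Real.pi_pos
  unfold eulerβ₂; split_ifs <;> first | exact mod2pi_lt _ | linarith

theorem eulerβ₃_lt (a b c : ℝ) : eulerβ₃ a b c < 2 * Real.pi := by
  have := Real.pi_pos
  unfold eulerβ₃; split_ifs <;> first | exact mod2pi_lt _ | linarith

/-- Weight `0` detects the presence of `H`: in the other one-wire axioms it occurs on both sides or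
on neither. -/
theorem not_derivable_HH : ¬ ∀ (n m : ℕ) (C D : Circuit n m), QCugp .HH n m C D →
    Derives (fun n m C' D' => ∃ b, b ≠ .HH ∧ QCugp b n m C' D') C D := by
  refine not_derivable_of_weight ⟨0, fun _ => 1, 1, 1⟩ 1 _ (by norm_num) ?_
    ⟨1, 1, _, _, .HH, le_rfl, by simp [Weight.eval]⟩
  rintro b hb n m C D (_ | _) hn <;> first | omega | simp_all [Weight.eval, RX]

/-- The invariant is the parity of the total number of gates `H` and `P`. -/
theorem not_derivable_P0 : ¬ ∀ (n m : ℕ) (C D : Circuit n m), QCugp .P0 n m C D →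
    Derives (fun n m C' D' => ∃ b, b ≠ .P0 ∧ QCugp b n m C' D') C D := by
  refine not_derivable_of_weight ⟨-1, fun _ => -1, 1, 1⟩ 1 _ (by norm_num) ?_
    ⟨1, 1, _, _, .P0, le_rfl, by simp [Weight.eval]⟩
  rintro b hb n m C D (_ | _) hn <;> first | omega | simp_all [Weight.eval, RX]

/-- The invariant is the parity of the number of `H`; each `RX` contains two. -/
theorem not_derivable_EH : ¬ ∀ (n m : ℕ) (C D : Circuit n m), QCugp .EH n m C D →
    Derives (fun n m C' D' => ∃ b, b ≠ .EH ∧ QCugp b n m C' D') C D := by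
  refine not_derivable_of_weight ⟨-1, fun _ => 1, 1, 1⟩ 1 _ (by norm_num) ?_
    ⟨1, 1, _, _, .EH, le_rfl, by simp [Weight.eval, RX]⟩
  rintro b hb n m C D (_ | _) hn <;> first | omega | simp_all [Weight.eval, RX]

open Classical in
theorem not_derivable_Euler : ¬ ∀ (n m : ℕ) (C D : Circuit n m), QCugp .Euler n m C D →
    Derives (fun n m C' D' => ∃ b, b ≠ .Euler ∧ QCugp b n m C' D') C D := by
  have hπ := Real.pi_pos
  -- The weight detects the gate `P (4π)`. The angles on the right of the Euler equation are all
  -- below `2π`, so this gate can only appear on the left; `P0` and `EH` involve only the angles `0`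
  -- and `π/2`.
  refine not_derivable_of_weight ⟨1, fun φ => if φ = 4 * Real.pi then 0 else 1, 1, 1⟩ 1 _
    (by norm_num) ?_ ⟨1, 1, _, _, .Euler 0 (4 * Real.pi) 0, le_rfl, ?_⟩
  · have h₁ : Real.pi / 2 ≠ 4 * Real.pi := by linarith
    have h₂ : (0 : ℝ) ≠ 4 * Real.pi := by positivity
    rintro b hb n m C D (_ | _) hn <;> first | omega | simp_all [Weight.eval, RX]
  · have h₁ := eulerβ₁_lt 0 (4 * Real.pi) 0
    have h₂ := eulerβ₂_lt 0 (4 * Real.pi) 0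
    have h₃ := eulerβ₃_lt 0 (4 * Real.pi) 0
    simp only [Weight.eval, RX]
    rw [if_neg (c := eulerβ₁ _ _ _ = _) (by linarith),
      if_neg (c := eulerβ₂ _ _ _ = _) (by linarith),
      if_neg (c := eulerβ₃ _ _ _ = _) (by linarith)]
    simp

/-- Among axioms on at most two wires, only `C` has `CNOT` on exactly one side. -/
theorem not_derivable_C : ¬ ∀ (n m : ℕ) (C D : Circuit n m), QCugp .C n m C D →
    Derives (fun n m C' D' => ∃ b, b ≠ .C ∧ QCugp b n m C' D') C D := by
  refine not_derivable_of_weight ⟨1, fun _ => 1, 0, 1⟩ 2 _ (by norm_num) ?_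
    ⟨2, 2, _, _, .C 0, le_rfl, by simp [Weight.eval]⟩
  rintro b hb n m C D (_ | _) hn <;> first | omega | simp_all [Weight.eval, RX, NOTC]

/-- The invariant is the parity of the number of swaps. -/
theorem not_derivable_B : ¬ ∀ (n m : ℕ) (C D : Circuit n m), QCugp .B n m C D →
    Derives (fun n m C' D' => ∃ b, b ≠ .B ∧ QCugp b n m C' D') C D := by
  refine not_derivable_of_weight ⟨1, fun _ => 1, 1, -1⟩ 2 _ (by norm_num) ?_
    ⟨2, 2, _, _, .B, le_rfl, by simp [Weight.eval, NOTC]⟩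
  rintro b hb n m C D (_ | _) hn <;> first | omega | simp_all [Weight.eval, RX]

/-- `CZ` changes the parity of the number of `CNOT`. So does `B`, and counting swaps as well
compensates for it. -/
theorem not_derivable_CZ : ¬ ∀ (n m : ℕ) (C D : Circuit n m), QCugp .CZ n m C D →
    Derives (fun n m C' D' => ∃ b, b ≠ .CZ ∧ QCugp b n m C' D') C D := by
  refine not_derivable_of_weight ⟨1, fun _ => 1, -1, -1⟩ 2 _ (by norm_num) ?_
    ⟨2, 2, _, _, .CZ, le_rfl, by simp [Weight.eval]⟩
  rintro b hb n m C D (_ | _) hn <;> first | omega | simp_all [Weight.eval, RX, NOTC]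

open Function

/-! ### Operators on infinitely many qubits -/

/-- Assignments of a bit to every wire. -/
abbrev Bits : Type := ℕ → Fin 2

/-- Operators on the functions of all the bits. -/
abbrev Operator : Type := Module.End ℂ (Bits → ℂ)

/-- A one-qubit matrix acting on the wire `k`. -/
def site (k : ℕ) (M : Matrix (Fin 2) (Fin 2) ℂ) : Operator where
  toFun ψ x := ∑ b, M (x k) b * ψ (update x k b)
  map_add' ψ ψ' := by ext x; simp [mul_add, Finset.sum_add_distrib]
  map_smul' c ψ := by ext x; simp; ring

/-- Composition with a map of assignments. -/
def pull (g : Bits → Bits) : Operator := LinearMap.funLeft ℂ ℂ g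

/-- Multiplication by a function of the bits. -/
def diag (f : Bits → ℂ) : Operator := LinearMap.mulLeft ℂ f

theorem site_apply (k : ℕ) (M : Matrix (Fin 2) (Fin 2) ℂ) (ψ : Bits → ℂ) (x : Bits) :
    site k M ψ x = ∑ b, M (x k) b * ψ (update x k b) := rfl

theorem pull_apply (g : Bits → Bits) (ψ : Bits → ℂ) (x : Bits) : pull g ψ x = ψ (g x) := rfl

theorem diag_apply (f ψ : Bits → ℂ) (x : Bits) : diag f ψ x = f x * ψ x := rfl

theorem pull_mul_pull (g g' : Bits → Bits) : pull g * pull g' = pull (g' ∘ g) := rfl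

theorem pull_id : pull id = 1 := rfl

theorem diag_mul_diag (f f' : Bits → ℂ) : diag f * diag f' = diag (f * f') := by
  ext ψ : 1; funext x; simp [Module.End.mul_apply, diag_apply, mul_assoc]

theorem pull_mul_diag (g : Bits → Bits) (f : Bits → ℂ) :
    pull g * diag f = diag (f ∘ g) * pull g := by
  ext ψ : 1; funext x; simp [Module.End.mul_apply, diag_apply, pull_apply]

theorem diag_const (c : ℂ) : diag (fun _ => c) = c • 1 := by
  ext ψ : 1; funext x; simp [diag_apply]

theorem site_mul_site (k : ℕ) (M N : Matrix (Fin 2) (Fin 2) ℂ) :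
    site k M * site k N = site k (M * N) := by
  ext ψ : 1; funext x
  simp [Module.End.mul_apply, site_apply, Matrix.mul_apply]
  ring

theorem site_smul (k : ℕ) (c : ℂ) (M : Matrix (Fin 2) (Fin 2) ℂ) :
    site k (c • M) = c • site k M := by
  ext ψ : 1; funext x
  simp [site_apply]
  ring

theorem site_diagonal (k : ℕ) (d : Fin 2 → ℂ) :
    site k (Matrix.diagonal d) = diag fun x => d (x k) := by
  ext ψ : 1; funext x
  rw [site_apply, diag_apply, Finset.sum_eq_single (x k)]
  · simp
  · intro b _ hb; simp [Matrix.diagonal_apply_ne' _ hb]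
  · simp

theorem site_one (k : ℕ) : site k 1 = 1 := by
  rw [← Matrix.diagonal_one, site_diagonal, diag_const, one_smul]

/-- The action on bits of a CNot with control `k` and target `k + 1`. -/
def cnotMap (k : ℕ) (x : Bits) : Bits := update x (k + 1) (x (k + 1) + x k)

/-- The exchange of the bits `k` and `k + 1`. -/
def swapMap (k : ℕ) (x : Bits) : Bits := update (update x k (x (k + 1))) (k + 1) (x k)

/-- `g` neither reads nor modifies the bit `j`. -/
def Ignores (g : Bits → Bits) (j : ℕ) : Prop :=
  ∀ x, g x j = x j ∧ ∀ b, g (update x j b) = update (g x) j b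

theorem ignores_cnotMap {k j : ℕ} (h : j ≠ k) (h' : j ≠ k + 1) : Ignores (cnotMap k) j := by
  refine fun x => ⟨by simp [cnotMap, h'], fun b => ?_⟩
  simp [cnotMap, h.symm, h'.symm, update_comm h'.symm]

theorem ignores_swapMap {k j : ℕ} (h : j ≠ k) (h' : j ≠ k + 1) : Ignores (swapMap k) j := by
  refine fun x => ⟨by simp [swapMap, h, h'], fun b => ?_⟩
  simp [swapMap, h.symm, h'.symm, update_comm h'.symm, update_comm h.symm]

theorem commute_site_site {k j : ℕ} (h : k ≠ j) (M N : Matrix (Fin 2) (Fin 2) ℂ) :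
    Commute (site k M) (site j N) := by
  ext ψ : 1; funext x
  simp only [Module.End.mul_apply, site_apply, Finset.mul_sum, update_of_ne h, update_of_ne h.symm]
  rw [Finset.sum_comm]
  refine Finset.sum_congr rfl fun b _ => Finset.sum_congr rfl fun c _ => ?_
  rw [update_comm h]; ring

theorem commute_pull_site {g : Bits → Bits} {j : ℕ} (h : Ignores g j)
    (M : Matrix (Fin 2) (Fin 2) ℂ) : Commute (pull g) (site j M) := by
  ext ψ : 1; funext x
  simp only [Module.End.mul_apply, site_apply, pull_apply, (h x).1, (h x).2]

theorem commute_pull_cnotMap {g : Bits → Bits} {j : ℕ} (h : Ignores g j) (h' : Ignores g (j + 1)) :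
    Commute (pull g) (pull (cnotMap j)) := by
  simp only [Commute, SemiconjBy, pull_mul_pull]
  congr 1; funext x
  simp only [comp_apply, cnotMap, (h x).1, (h' x).1, (h' x).2]

theorem commute_pull_swapMap {g : Bits → Bits} {j : ℕ} (h : Ignores g j) (h' : Ignores g (j + 1)) :
    Commute (pull g) (pull (swapMap j)) := by
  simp only [Commute, SemiconjBy, pull_mul_pull]
  congr 1; funext x
  simp only [comp_apply, swapMap, (h x).1, (h' x).1, (h' _).2, (h _).2]

@[simp] theorem swapMap_left (k : ℕ) (x : Bits) : swapMap k x k = x (k + 1) := by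
  simp [swapMap]

@[simp] theorem swapMap_right (k : ℕ) (x : Bits) : swapMap k x (k + 1) = x k := by
  simp [swapMap]

theorem swapMap_of_ne {k j : ℕ} (h : j ≠ k) (h' : j ≠ k + 1) (x : Bits) : swapMap k x j = x j :=
  (ignores_swapMap h h' x).1

@[simp] theorem cnotMap_left (k : ℕ) (x : Bits) : cnotMap k x k = x k := by
  simp [cnotMap]

@[simp] theorem cnotMap_right (k : ℕ) (x : Bits) : cnotMap k x (k + 1) = x (k + 1) + x k := by
  simp [cnotMap]

theorem cnotMap_of_ne {k j : ℕ} (h : j ≠ k + 1) (x : Bits) : cnotMap k x j = x j := by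
  simp [cnotMap, h]

theorem swapMap_comp_swapMap (k : ℕ) : swapMap k ∘ swapMap k = id := by
  funext x j
  by_cases h : j = k
  · subst h; simp
  by_cases h' : j = k + 1
  · subst h'; simp
  simp [swapMap_of_ne h h']

theorem fin_two_add_add (a b : Fin 2) : a + b + b = a := by
  revert a b; decide

theorem cnotMap_comp_cnotMap (k : ℕ) : cnotMap k ∘ cnotMap k = id := by
  funext x j
  by_cases h' : j = k + 1
  · subst h'; simp [fin_two_add_add]
  simp [cnotMap_of_ne h']

theorem pull_swapMap_mul_site (k : ℕ) (M : Matrix (Fin 2) (Fin 2) ℂ) :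
    pull (swapMap k) * site k M = site (k + 1) M * pull (swapMap k) := by
  ext ψ : 1; funext x
  simp only [Module.End.mul_apply, site_apply, pull_apply, swapMap_left]
  refine Finset.sum_congr rfl fun b _ => ?_
  congr 2
  simp [swapMap, update_comm (show k + 1 ≠ k by omega)]

/-- Maps of bits which agree on three consecutive bits and fix the others are equal. -/
theorem bits_ext_three {k : ℕ} {x y : Bits} (h₀ : x k = y k) (h₁ : x (k + 1) = y (k + 1))
    (h₂ : x (k + 1 + 1) = y (k + 1 + 1))
    (h : ∀ j, j ≠ k → j ≠ k + 1 → j ≠ k + 1 + 1 → x j = y j) : x = y := by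
  funext j
  by_cases h0 : j = k
  · rw [h0, h₀]
  by_cases h1 : j = k + 1
  · rw [h1, h₁]
  by_cases h2 : j = k + 1 + 1
  · rw [h2, h₂]
  exact h j h0 h1 h2

/-- The `CNOT` case of the naturality of `sigma`, up to scalars. -/
theorem pull_swapMap_swapMap_cnotMap (k : ℕ) :
    pull (swapMap k) * pull (swapMap (k + 1)) * pull (cnotMap k) =
      pull (cnotMap (k + 1)) * (pull (swapMap k) * pull (swapMap (k + 1))) := by
  simp only [pull_mul_pull]
  have h : k ≠ k + 1 + 1 := by omega
  have h' : k + 1 + 1 ≠ k := by omega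
  congr 1; funext x
  refine bits_ext_three (k := k) ?_ ?_ ?_ fun j h0 h1 h2 => ?_ <;>
    simp [swapMap, cnotMap, *]

theorem pull_swapMap_swapMap_swapMap (k : ℕ) :
    pull (swapMap k) * pull (swapMap (k + 1)) * pull (swapMap k) =
      pull (swapMap (k + 1)) * (pull (swapMap k) * pull (swapMap (k + 1))) := by
  simp only [pull_mul_pull]
  have h : k ≠ k + 1 + 1 := by omega
  have h' : k + 1 + 1 ≠ k := by omega
  congr 1; funext x
  refine bits_ext_three (k := k) ?_ ?_ ?_ fun j h0 h1 h2 => ?_ <;>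
    simp [swapMap, *]

/-! ### Interpretation of circuits -/

/-- The matrix of determinant `1` proportional to `P φ`. -/
noncomputable def rz (φ : ℝ) : Matrix (Fin 2) (Fin 2) ℂ :=
  Matrix.diagonal ![Complex.exp (-(φ / 2 : ℝ) * Complex.I), Complex.exp ((φ / 2 : ℝ) * Complex.I)]

/-- The matrix of determinant `1` proportional to the Hadamard matrix. -/
noncomputable def hadamard : Matrix (Fin 2) (Fin 2) ℂ :=
  (Complex.I / (√2 : ℝ)) • !![1, 1; 1, -1]

/-- `exp (iπ/4)` -/
noncomputable def eighthRoot : ℂ := Complex.exp ((Real.pi / 4 : ℝ) * Complex.I)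

/-- The special unitary interpretation of a circuit whose first wire is the wire `k`. -/
noncomputable def interp : ∀ {n m : ℕ}, Circuit n m → ℕ → Operator
  | _, _, .H, k => site k hadamard
  | _, _, .P φ, k => site k (rz φ)
  | _, _, .CNOT, k => eighthRoot • pull (cnotMap k)
  | _, _, .empty, _ => 1
  | _, _, .wire, _ => 1
  | _, _, .swap, k => eighthRoot • pull (swapMap k)
  | _, _, .seq C D, k => interp D k * interp C k
  | _, _, .tensor (n₁ := n₁) C D, k => interp C k * interp D (k + n₁)

@[simp] theorem interp_cast {n m n' m' : ℕ} (hn : n = n') (hm : m = m') (C : Circuit n m) (k : ℕ) :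
    interp (C.cast hn hm) k = interp C k := by
  subst hn hm; rfl

@[simp] theorem interp_wires (n k : ℕ) : interp (wires n) k = 1 := by
  induction n generalizing k with
  | zero => rfl
  | succ n ih => simp [wires, interp, ih]

/-- `A` commutes with all the gates on the wires from `l` on. -/
structure CommutesFrom (l : ℕ) (A : Operator) : Prop where
  site : ∀ j, l ≤ j → ∀ M, Commute A (site j M)
  cnot : ∀ j, l ≤ j → Commute A (pull (cnotMap j))
  swap : ∀ j, l ≤ j → Commute A (pull (swapMap j))

theorem CommutesFrom.mono {l l' : ℕ} (h : l ≤ l') {A : Operator} (hA : CommutesFrom l A) :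
    CommutesFrom l' A :=
  ⟨fun j hj => hA.site j (h.trans hj), fun j hj => hA.cnot j (h.trans hj),
    fun j hj => hA.swap j (h.trans hj)⟩

theorem CommutesFrom.mul {l : ℕ} {A B : Operator} (hA : CommutesFrom l A) (hB : CommutesFrom l B) :
    CommutesFrom l (A * B) :=
  ⟨fun j hj M => (hA.site j hj M).mul_left (hB.site j hj M),
    fun j hj => (hA.cnot j hj).mul_left (hB.cnot j hj),
    fun j hj => (hA.swap j hj).mul_left (hB.swap j hj)⟩

theorem CommutesFrom.smul {l : ℕ} {A : Operator} (hA : CommutesFrom l A) (c : ℂ) :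
    CommutesFrom l (c • A) :=
  ⟨fun j hj M => (hA.site j hj M).smul_left c, fun j hj => (hA.cnot j hj).smul_left c,
    fun j hj => (hA.swap j hj).smul_left c⟩

theorem commutesFrom_one (l : ℕ) : CommutesFrom l 1 :=
  ⟨fun _ _ _ => Commute.one_left _, fun _ _ => Commute.one_left _, fun _ _ => Commute.one_left _⟩

theorem commutesFrom_site (k : ℕ) (M : Matrix (Fin 2) (Fin 2) ℂ) :
    CommutesFrom (k + 1) (site k M) :=
  ⟨fun _ hj _ => commute_site_site (by omega) _ _,
    fun _ hj => (commute_pull_site (ignores_cnotMap (by omega) (by omega)) _).symm,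
    fun _ hj => (commute_pull_site (ignores_swapMap (by omega) (by omega)) _).symm⟩

theorem commutesFrom_pull {g : Bits → Bits} {l : ℕ} (h : ∀ j, l ≤ j → Ignores g j) :
    CommutesFrom l (pull g) :=
  ⟨fun _ hj => commute_pull_site (h _ hj),
    fun _ hj => commute_pull_cnotMap (h _ hj) (h _ (by omega)),
    fun _ hj => commute_pull_swapMap (h _ hj) (h _ (by omega))⟩

theorem commutesFrom_interp {n m : ℕ} (C : Circuit n m) (k : ℕ) :
    CommutesFrom (k + n) (interp C k) := by
  induction C generalizing k with
  | H => exact commutesFrom_site _ _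
  | P φ => exact commutesFrom_site _ _
  | CNOT => exact (commutesFrom_pull fun j hj => ignores_cnotMap (by omega) (by omega)).smul _
  | empty => exact commutesFrom_one _
  | wire => exact commutesFrom_one _
  | swap => exact (commutesFrom_pull fun j hj => ignores_swapMap (by omega) (by omega)).smul _
  | seq C D ihC ihD =>
    obtain rfl := C.wires_eq
    exact (ihD k).mul (ihC k)
  | tensor C D ihC ihD =>
    exact ((ihC k).mono (by omega)).mul ((ihD _).mono (by omega))

theorem CommutesFrom.commute_interp {l : ℕ} {A : Operator} (hA : CommutesFrom l A) {n m : ℕ}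
    (C : Circuit n m) (k : ℕ) (h : l ≤ k) : Commute A (interp C k) := by
  induction C generalizing k with
  | H => exact hA.site _ h _
  | P φ => exact hA.site _ h _
  | CNOT => exact (hA.cnot _ h).smul_right _
  | empty => exact Commute.one_right _
  | wire => exact Commute.one_right _
  | swap => exact (hA.swap _ h).smul_right _
  | seq C D ihC ihD => exact (ihD k h).mul_right (ihC k h)
  | tensor C D ihC ihD => exact (ihC k h).mul_right (ihD _ (by omega))

theorem commute_interp {n m n' m' : ℕ} (C : Circuit n m) (D : Circuit n' m') {k l : ℕ}
    (h : k + n ≤ l) : Commute (interp C k) (interp D l) :=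
  (commutesFrom_interp C k).commute_interp D l h

theorem interp_sigma_succ (n k : ℕ) :
    interp (sigma (n + 1)) k = eighthRoot • pull (swapMap k) * interp (sigma n) (k + 1) := by
  simp [sigma, interp]

theorem interp_sigma_zero (k : ℕ) : interp (sigma 0) k = 1 := rfl

/-- The moving wire passes the lower `p` wires, then the upper `n`. -/
theorem interp_sigma_add (n p k : ℕ) :
    interp (sigma (n + p)) k = interp (sigma n) k * interp (sigma p) (k + n) := by
  induction n generalizing k with
  | zero =>
    rw [interp_sigma_zero, one_mul]
    exact congrArg (fun q => interp (sigma q) k) (Nat.zero_add p)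
  | succ n ih =>
    rw [show n + 1 + p = n + p + 1 by omega, interp_sigma_succ, interp_sigma_succ, ih,
      show k + 1 + n = k + (n + 1) by omega, mul_assoc]

/-- Naturality holds without any phase, since both sides contain the same number of swaps. -/
theorem interp_sigma_mul {n m : ℕ} (C : Circuit n m) (k : ℕ) :
    interp (sigma m) k * interp C k = interp C (k + 1) * interp (sigma n) k := by
  induction C generalizing k with
  | H => simp [interp, interp_sigma_succ, interp_sigma_zero, pull_swapMap_mul_site]
  | P φ => simp [interp, interp_sigma_succ, interp_sigma_zero, pull_swapMap_mul_site]
  | CNOT =>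
    simp only [interp, interp_sigma_succ, interp_sigma_zero, mul_one, smul_mul_assoc,
      mul_smul_comm, pull_swapMap_swapMap_cnotMap]
  | empty => simp [interp]
  | wire => simp [interp]
  | swap =>
    simp only [interp, interp_sigma_succ, interp_sigma_zero, mul_one, smul_mul_assoc,
      mul_smul_comm, pull_swapMap_swapMap_swapMap]
  | seq C D ihC ihD =>
    simp only [interp]
    rw [← mul_assoc, ihD, mul_assoc, ihC, mul_assoc]
  | @tensor n₁ m₁ n₂ m₂ C D ihC ihD =>
    obtain rfl := C.wires_eq
    obtain rfl := D.wires_eq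
    simp only [interp, interp_sigma_add]
    have h := (commute_interp C (sigma n₂) (k := k) le_rfl).eq
    have h' := (commute_interp (sigma n₁) D (k := k) (l := k + 1 + n₁) (by omega)).eq
    calc interp (sigma n₁) k * interp (sigma n₂) (k + n₁) * (interp C k * interp D (k + n₁))
        = interp (sigma n₁) k * (interp C k * interp (sigma n₂) (k + n₁)) * interp D (k + n₁) := by
          rw [h]; simp only [mul_assoc]
      _ = interp C (k + 1) * (interp (sigma n₁) k * interp D (k + 1 + n₁))
            * interp (sigma n₂) (k + n₁) := by
          rw [← mul_assoc, ihC, mul_assoc, ihD]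
          simp only [mul_assoc, add_assoc, add_comm n₁ 1]
      _ = _ := by rw [h']; simp only [mul_assoc]

/-! ### Soundness up to phases -/

/-- The interpretations of `C` and `D` are equal up to a root of unity of order dividing
`2 ^ d`. -/
def EqPhase (d : ℕ) {n m : ℕ} (C D : Circuit n m) : Prop :=
  ∃ κ : ℂ, κ ^ 2 ^ d = 1 ∧ ∀ k, interp C k = κ • interp D k

theorem pow_two_pow_mono {κ : ℂ} {d d' : ℕ} (h : d ≤ d') (hκ : κ ^ 2 ^ d = 1) :
    κ ^ 2 ^ d' = 1 := by
  obtain ⟨c, hc⟩ := pow_dvd_pow 2 h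
  rw [hc, pow_mul, hκ, one_pow]

theorem ne_zero_of_pow_two_pow {κ : ℂ} {d : ℕ} (hκ : κ ^ 2 ^ d = 1) : κ ≠ 0 := by
  rintro rfl
  simp at hκ

theorem EqPhase.of_eq (d : ℕ) {n m : ℕ} {C D : Circuit n m} (h : ∀ k, interp C k = interp D k) :
    EqPhase d C D :=
  ⟨1, one_pow _, fun k => by rw [h, one_smul]⟩

theorem eighthRoot_sq : eighthRoot ^ 2 = Complex.I := by
  rw [eighthRoot, ← Complex.exp_nat_mul]
  refine Eq.trans (congrArg _ ?_) Complex.exp_pi_div_two_mul_I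
  push_cast
  ring

theorem eighthRoot_mul_self : eighthRoot * eighthRoot = Complex.I := by
  rw [← sq, eighthRoot_sq]

/-- Monotonicity lets the phases of tensor factors count as phases of the wider circuit. Among the
prop laws only `swap_swap` creates a phase, namely `i`, whence `2 ≤ d 2`. -/
theorem eqPhase_of_derives {d : ℕ → ℕ} (hd : Monotone d) (hd₂ : 2 ≤ d 2)
    {Γ : ∀ n m : ℕ, Circuit n m → Circuit n m → Prop}
    (hΓ : ∀ n m C D, Γ n m C D → EqPhase (d n) C D)
    {n m : ℕ} {C D : Circuit n m} (h : Derives Γ C D) : EqPhase (d n) C D := by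
  induction h with
  | ax h => exact hΓ _ _ _ _ h
  | refl C => exact .of_eq _ fun _ => rfl
  | symm _ ih =>
    obtain ⟨κ, hκ, h⟩ := ih
    refine ⟨κ⁻¹, by rw [inv_pow, hκ, inv_one], fun k => ?_⟩
    rw [h, inv_smul_smul₀ (ne_zero_of_pow_two_pow hκ)]
  | trans _ _ ih₁ ih₂ =>
    obtain ⟨κ, hκ, h⟩ := ih₁
    obtain ⟨κ', hκ', h'⟩ := ih₂
    exact ⟨κ * κ', by rw [mul_pow, hκ, hκ', one_mul], fun k => by rw [h, h', smul_smul]⟩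
  | @seq_congr n m k C C' D D' _ _ ih₁ ih₂ =>
    obtain rfl := C.wires_eq
    obtain ⟨κ, hκ, h⟩ := ih₁
    obtain ⟨κ', hκ', h'⟩ := ih₂
    refine ⟨κ' * κ, by rw [mul_pow, hκ, hκ', one_mul], fun k => ?_⟩
    simp only [interp]
    rw [h, h', smul_mul_smul_comm]
  | tensor_congr _ _ ih₁ ih₂ =>
    obtain ⟨κ, hκ, h⟩ := ih₁
    obtain ⟨κ', hκ', h'⟩ := ih₂
    refine ⟨κ * κ', ?_, fun k => ?_⟩
    · rw [mul_pow, pow_two_pow_mono (hd (Nat.le_add_right _ _)) hκ,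
        pow_two_pow_mono (hd (Nat.le_add_left _ _)) hκ', one_mul]
    · simp only [interp]
      rw [h, h', smul_mul_smul_comm]
  | seq_assoc C D E => exact .of_eq _ fun k => by simp only [interp, mul_assoc]
  | tensor_assoc C D E =>
    exact .of_eq _ fun k => by simp only [interp_cast, interp, mul_assoc, add_assoc]
  | interchange C₁ C₂ C₃ C₄ =>
    refine .of_eq _ fun k => ?_
    obtain rfl := C₁.wires_eq
    simp only [interp]
    have h := (commute_interp C₁ C₄ (k := k) le_rfl).eq
    rw [mul_assoc, ← mul_assoc (interp C₄ _), ← h]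
    simp only [mul_assoc]
  | tensor_empty C => exact .of_eq _ fun k => by simp [interp]
  | empty_tensor C => exact .of_eq _ fun k => by simp [interp]
  | wires_seq C => exact .of_eq _ fun k => by simp [interp]
  | seq_wires C => exact .of_eq _ fun k => by simp [interp]
  | swap_swap =>
    refine ⟨Complex.I, pow_two_pow_mono hd₂ (by norm_num), fun k => ?_⟩
    simp only [interp, smul_mul_smul_comm, eighthRoot_mul_self, pull_mul_pull,
      swapMap_comp_swapMap, pull_id, mul_one]
  | sigma_natural C =>
    refine .of_eq _ fun k => ?_
    simp only [interp, one_mul, mul_one, interp_sigma_mul]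

/-! ### The equations on one wire -/

/-- The matrix of determinant `1` proportional to `RX θ`. -/
noncomputable def rx (θ : ℝ) : Matrix (Fin 2) (Fin 2) ℂ :=
  !![(Real.cos (θ / 2) : ℂ), -(Complex.I * Real.sin (θ / 2));
    -(Complex.I * Real.sin (θ / 2)), (Real.cos (θ / 2) : ℂ)]

theorem rz_eq (φ : ℝ) : rz φ = !![(Real.cos (φ / 2) : ℂ) - Complex.I * Real.sin (φ / 2), 0;
    0, (Real.cos (φ / 2) : ℂ) + Complex.I * Real.sin (φ / 2)] := by
  rw [rz, Complex.ofReal_cos, Complex.ofReal_sin, Complex.exp_mul_I, Complex.exp_mul_I]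
  generalize ((φ / 2 : ℝ) : ℂ) = t
  ext i j
  fin_cases i <;> fin_cases j <;> simp <;> ring

theorem hadamard_scalar_sq : (Complex.I / (√2 : ℝ)) * (Complex.I / (√2 : ℝ)) = -(1 / 2 : ℂ) := by
  rw [div_mul_div_comm, Complex.I_mul_I, ← Complex.ofReal_mul, Real.mul_self_sqrt (by norm_num)]
  push_cast
  ring

theorem hadamard_mul_self : hadamard * hadamard = (-1 : ℂ) • 1 := by
  rw [hadamard, smul_mul_smul_comm, hadamard_scalar_sq, Matrix.mul_fin_two, Matrix.one_fin_two]
  ext i j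
  fin_cases i <;> fin_cases j <;> norm_num

theorem hadamard_rz_hadamard (θ : ℝ) : hadamard * (rz θ * hadamard) = (-1 : ℂ) • rx θ := by
  rw [hadamard, mul_smul_comm, smul_mul_smul_comm, hadamard_scalar_sq, rz_eq, rx,
    Matrix.mul_fin_two, Matrix.mul_fin_two]
  ext i j
  fin_cases i <;> fin_cases j <;> simp <;> ring

theorem interp_RX (θ : ℝ) (k : ℕ) : interp (RX θ) k = (-1 : ℂ) • site k (rx θ) := by
  simp only [RX, interp, site_mul_site, hadamard_rz_hadamard, site_smul]

/-- This sign cancels the one in `interp_RX`, so `EH` holds exactly. -/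
theorem hadamard_eq : hadamard = (-1 : ℂ) •
    (rz (Real.pi / 2) * (rx (Real.pi / 2) * rz (Real.pi / 2))) := by
  have h : (√2 : ℂ) * √2 = 2 := by
    rw [← Complex.ofReal_mul, Real.mul_self_sqrt (by norm_num)]; norm_num
  have h₀ : (√2 : ℂ) ≠ 0 := fun h' => by simp [h'] at h
  have h₄ : (√2 : ℂ) ^ 4 = 4 := by linear_combination ((√2 : ℂ) ^ 2 + 2) * h
  have hI := Complex.I_mul_I
  rw [hadamard, rz_eq, rx, Matrix.mul_fin_two, Matrix.mul_fin_two,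
    show Real.pi / 2 / 2 = Real.pi / 4 by ring, Real.cos_pi_div_four, Real.sin_pi_div_four]
  ext i j
  fin_cases i <;> fin_cases j <;> simp <;> field_simp
  · linear_combination (1 - Complex.I) ^ 2 * h₄ + 4 * hI
  · linear_combination -(1 - Complex.I) * (1 + Complex.I) * h₄ + 4 * hI
  · linear_combination -(1 - Complex.I) * (1 + Complex.I) * h₄ + 4 * hI
  · linear_combination -(1 + Complex.I) ^ 2 * h₄ - 4 * hI

/-- The special unitary matrix with given second column. -/
def specialUnitary (z z' : ℂ) : Matrix (Fin 2) (Fin 2) ℂ :=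
  !![starRingEnd ℂ z, -(Complex.I * z'); -(Complex.I * starRingEnd ℂ z'), z]

theorem rx_rz_rx (α₁ α₂ α₃ : ℝ) :
    rx α₃ * (rz α₂ * rx α₁) = specialUnitary (eulerZ α₁ α₂ α₃) (eulerZ' α₁ α₂ α₃) := by
  rw [rx, rz_eq, rx, Matrix.mul_fin_two, Matrix.mul_fin_two, specialUnitary, eulerZ, eulerZ',
    show (α₁ + α₃) / 2 = α₁ / 2 + α₃ / 2 by ring, show (α₁ - α₃) / 2 = α₁ / 2 - α₃ / 2 by ring]
  simp only [Real.cos_add, Real.cos_sub, Real.sin_add, Real.sin_sub]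
  generalize Real.cos (α₁ / 2) = c₁
  generalize Real.sin (α₁ / 2) = s₁
  generalize Real.cos (α₂ / 2) = c₂
  generalize Real.sin (α₂ / 2) = s₂
  generalize Real.cos (α₃ / 2) = c₃
  generalize Real.sin (α₃ / 2) = s₃
  ext i j
  fin_cases i <;> fin_cases j <;> apply Complex.ext <;> simp <;> ring

theorem rz_rx_rz (β₁ β₂ β₃ : ℝ) : rz β₃ * (rx β₂ * rz β₁) = specialUnitary
    (Real.cos (β₂ / 2) * Complex.exp (((β₁ + β₃) / 2 : ℝ) * Complex.I))
    (Real.sin (β₂ / 2) * Complex.exp (((β₁ - β₃) / 2 : ℝ) * Complex.I)) := by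
  rw [rx, rz_eq, rz_eq, Matrix.mul_fin_two, Matrix.mul_fin_two, specialUnitary,
    Complex.exp_mul_I, Complex.exp_mul_I, ← Complex.ofReal_cos, ← Complex.ofReal_cos,
    ← Complex.ofReal_sin, ← Complex.ofReal_sin,
    show (β₁ + β₃) / 2 = β₁ / 2 + β₃ / 2 by ring, show (β₁ - β₃) / 2 = β₁ / 2 - β₃ / 2 by ring]
  simp only [Real.cos_add, Real.cos_sub, Real.sin_add, Real.sin_sub]
  generalize Real.cos (β₁ / 2) = c₁
  generalize Real.sin (β₁ / 2) = s₁
  generalize Real.cos (β₂ / 2) = c₂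
  generalize Real.sin (β₂ / 2) = s₂
  generalize Real.cos (β₃ / 2) = c₃
  generalize Real.sin (β₃ / 2) = s₃
  ext i j
  fin_cases i <;> fin_cases j <;> apply Complex.ext <;> simp <;> ring

/-- The matrices depend on half angles, so reduction modulo `2π` costs only a sign. -/
theorem exists_mod2pi_eq (x : ℝ) : ∃ n : ℤ, mod2pi x / 2 = x / 2 - n * Real.pi := by
  refine ⟨toIcoDiv Real.two_pi_pos 0 x, ?_⟩
  rw [mod2pi, toIcoMod, zsmul_eq_mul]
  ring

theorem neg_one_zpow_sq (n : ℤ) : ((-1 : ℝ) ^ n) ^ 2 = 1 := by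
  rw [← zpow_natCast, ← zpow_mul, mul_comm, zpow_mul]; norm_num

theorem exists_rz_mod2pi (x : ℝ) : ∃ s : ℂ, s ^ 2 = 1 ∧ rz (mod2pi x) = s • rz x := by
  obtain ⟨n, hn⟩ := exists_mod2pi_eq x
  refine ⟨((-1 : ℝ) ^ n : ℝ), by rw [← Complex.ofReal_pow, neg_one_zpow_sq, Complex.ofReal_one], ?_⟩
  rw [rz_eq, rz_eq, hn, Real.cos_sub_int_mul_pi, Real.sin_sub_int_mul_pi, Complex.ofReal_mul,
    Complex.ofReal_mul]
  generalize ((-1 : ℝ) ^ n : ℝ) = s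
  ext i j
  fin_cases i <;> fin_cases j <;> simp <;> ring

theorem exists_rx_mod2pi (x : ℝ) : ∃ s : ℂ, s ^ 2 = 1 ∧ rx (mod2pi x) = s • rx x := by
  obtain ⟨n, hn⟩ := exists_mod2pi_eq x
  refine ⟨((-1 : ℝ) ^ n : ℝ), by rw [← Complex.ofReal_pow, neg_one_zpow_sq, Complex.ofReal_one], ?_⟩
  rw [rx, rx, hn, Real.cos_sub_int_mul_pi, Real.sin_sub_int_mul_pi, Complex.ofReal_mul,
    Complex.ofReal_mul]
  generalize ((-1 : ℝ) ^ n : ℝ) = s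
  ext i j
  fin_cases i <;> fin_cases j <;> simp <;> ring

theorem normSq_eulerZ_add (α₁ α₂ α₃ : ℝ) :
    ‖eulerZ α₁ α₂ α₃‖ ^ 2 + ‖eulerZ' α₁ α₂ α₃‖ ^ 2 = 1 := by
  rw [Complex.sq_norm, Complex.sq_norm, Complex.normSq_apply, Complex.normSq_apply]
  simp only [eulerZ, eulerZ']
  have h₁ := Real.sin_sq_add_cos_sq (α₂ / 2)
  have h₂ := Real.sin_sq_add_cos_sq ((α₁ + α₃) / 2)
  have h₃ := Real.sin_sq_add_cos_sq ((α₁ - α₃) / 2)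
  linear_combination h₁ + Real.cos (α₂ / 2) ^ 2 * h₂ + Real.sin (α₂ / 2) ^ 2 * h₃

/-- The number `i + a/b` is `(a + ib)/b`, of norm `1/b`. With `a = |z|` and `b = |z'|`, this
computes the cosine and sine of `β₂/2`. -/
theorem cos_sin_arg_I_add {a b : ℝ} (_ : 0 ≤ a) (hb : 0 < b) (h : a ^ 2 + b ^ 2 = 1) :
    Real.cos (Complex.I + ((a / b : ℝ) : ℂ)).arg = a ∧
      Real.sin (Complex.I + ((a / b : ℝ) : ℂ)).arg = b := by
  have hn : ‖Complex.I + ((a / b : ℝ) : ℂ)‖ = 1 / b := by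
    rw [← sq_eq_sq₀ (norm_nonneg _) (by positivity), Complex.sq_norm, Complex.normSq_apply]
    simp only [Complex.add_re, Complex.I_re, Complex.ofReal_re, Complex.add_im, Complex.I_im,
      Complex.ofReal_im]
    field_simp
    linarith
  have h₀ : Complex.I + ((a / b : ℝ) : ℂ) ≠ 0 := by
    rw [← norm_pos_iff, hn]; positivity
  rw [Complex.cos_arg h₀, Complex.sin_arg, hn]
  simp only [Complex.add_re, Complex.I_re, Complex.ofReal_re, Complex.add_im, Complex.I_im,
    Complex.ofReal_im]
  constructor <;> field_simp <;> simp

/-- Both products have the form `specialUnitary`, so only `z` and `z'` must match: the `β` angles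
encode their polar forms, up to signs from `mod2pi`. -/
theorem exists_euler_sign (α₁ α₂ α₃ : ℝ) : ∃ s : ℂ, s ^ 2 = 1 ∧
    rz (eulerβ₃ α₁ α₂ α₃) * (rx (eulerβ₂ α₁ α₂ α₃) * rz (eulerβ₁ α₁ α₂ α₃)) =
      s • (rx α₃ * (rz α₂ * rx α₁)) := by
  rw [rx_rz_rx]
  have hn := normSq_eulerZ_add α₁ α₂ α₃
  unfold eulerβ₁ eulerβ₂ eulerβ₃
  generalize eulerZ α₁ α₂ α₃ = z at *
  generalize eulerZ' α₁ α₂ α₃ = z' at *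
  have hz := Complex.norm_mul_exp_arg_mul_I z
  have hz' := Complex.norm_mul_exp_arg_mul_I z'
  split_ifs with h h'
  · obtain ⟨s, hs, he⟩ := exists_rz_mod2pi (2 * z.arg)
    refine ⟨s, hs, ?_⟩
    rw [he, mul_smul_comm, mul_smul_comm, rz_rx_rz]
    have : ‖z‖ = 1 := by
      simpa [h, pow_eq_one_iff_of_nonneg (norm_nonneg z)] using hn
    rw [this] at hz
    congr 2
    · simpa using hz
    · simp [h]
  · obtain ⟨s, hs, he⟩ := exists_rz_mod2pi (2 * z'.arg)
    refine ⟨s, hs, ?_⟩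
    rw [he, mul_smul_comm, mul_smul_comm, rz_rx_rz]
    have : ‖z'‖ = 1 := by
      simpa [h', pow_eq_one_iff_of_nonneg (norm_nonneg z')] using hn
    rw [this] at hz'
    congr 2
    · simp [h', -Complex.ofReal_div, -Complex.ofReal_cos]
    · simpa [-Complex.ofReal_sin] using hz'
  · obtain ⟨s₁, hs₁, he₁⟩ := exists_rz_mod2pi (z.arg + z'.arg)
    obtain ⟨s₂, hs₂, he₂⟩ :=
      exists_rx_mod2pi (2 * (Complex.I + (‖z / z'‖ : ℂ)).arg)
    obtain ⟨s₃, hs₃, he₃⟩ := exists_rz_mod2pi (z.arg - z'.arg)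
    refine ⟨s₃ * (s₂ * s₁), by rw [mul_pow, mul_pow, hs₁, hs₂, hs₃]; norm_num, ?_⟩
    rw [he₁, he₂, he₃, smul_mul_smul_comm, smul_mul_smul_comm, rz_rx_rz]
    obtain ⟨hc, hs⟩ := cos_sin_arg_I_add (norm_nonneg z) (norm_pos_iff.2 h) hn
    rw [← norm_div] at hc hs
    rw [mul_div_cancel_left₀ _ two_ne_zero, hc, hs,
      show (z.arg + z'.arg + (z.arg - z'.arg)) / 2 = z.arg by ring,
      show (z.arg + z'.arg - (z.arg - z'.arg)) / 2 = z'.arg by ring, hz, hz']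

theorem eqPhase_HH {d : ℕ} (hd : 1 ≤ d) : EqPhase d (H ⨟ᶜ H) wire := by
  refine ⟨-1, pow_two_pow_mono hd (by norm_num), fun k => ?_⟩
  simp only [interp, site_mul_site, hadamard_mul_self, site_smul, site_one]

theorem rz_zero : rz 0 = 1 := by
  rw [rz_eq, Matrix.one_fin_two]; simp

theorem eqPhase_P0 (d : ℕ) : EqPhase d (P 0) wire :=
  .of_eq _ fun k => by simp only [interp, rz_zero, site_one]

theorem eqPhase_EH (d : ℕ) :
    EqPhase d H (P (Real.pi / 2) ⨟ᶜ RX (Real.pi / 2) ⨟ᶜ P (Real.pi / 2)) := by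
  refine .of_eq _ fun k => ?_
  simp only [interp, interp_RX, smul_mul_assoc, mul_smul_comm, site_mul_site]
  rw [← site_smul, ← hadamard_eq]

theorem eqPhase_Euler {d : ℕ} (hd : 1 ≤ d) (α₁ α₂ α₃ : ℝ) :
    EqPhase d (RX α₁ ⨟ᶜ P α₂ ⨟ᶜ RX α₃)
      (P (eulerβ₁ α₁ α₂ α₃) ⨟ᶜ RX (eulerβ₂ α₁ α₂ α₃) ⨟ᶜ P (eulerβ₃ α₁ α₂ α₃)) := by
  obtain ⟨s, hs, h⟩ := exists_euler_sign α₁ α₂ α₃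
  -- Each `RX` carries a factor `-1`: two on the left, one on the right.
  refine ⟨-s, pow_two_pow_mono hd (by simpa using hs), fun k => ?_⟩
  simp only [interp, interp_RX, smul_mul_assoc, mul_smul_comm, site_mul_site, h, site_smul,
    smul_smul]
  congr 1
  linear_combination -hs

/-! ### The equations on two wires -/

theorem pull_swapMap_mul_self (k : ℕ) : pull (swapMap k) * pull (swapMap k) = 1 := by
  rw [pull_mul_pull, swapMap_comp_swapMap, pull_id]

theorem pull_cnotMap_mul_self (k : ℕ) : pull (cnotMap k) * pull (cnotMap k) = 1 := by
  rw [pull_mul_pull, cnotMap_comp_cnotMap, pull_id]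

theorem conj_swap (k : ℕ) (f : Bits → ℂ) :
    (eighthRoot • pull (swapMap k)) * (diag f * (eighthRoot • pull (swapMap k))) =
      Complex.I • diag (f ∘ swapMap k) := by
  simp only [smul_mul_assoc, mul_smul_comm, smul_smul, eighthRoot_mul_self]
  rw [← mul_assoc, pull_mul_diag, mul_assoc, pull_swapMap_mul_self, mul_one]

theorem conj_cnot (k : ℕ) (f : Bits → ℂ) :
    (eighthRoot • pull (cnotMap k)) * (diag f * (eighthRoot • pull (cnotMap k))) =
      Complex.I • diag (f ∘ cnotMap k) := by
  simp only [smul_mul_assoc, mul_smul_comm, smul_smul, eighthRoot_mul_self]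
  rw [← mul_assoc, pull_mul_diag, mul_assoc, pull_cnotMap_mul_self, mul_one]

theorem conj_cnot_mul (k : ℕ) (f : Bits → ℂ) (A : Operator) :
    (eighthRoot • pull (cnotMap k)) * (diag f * ((eighthRoot • pull (cnotMap k)) * A)) =
      Complex.I • (diag (f ∘ cnotMap k) * A) := by
  rw [← mul_assoc (diag f), ← mul_assoc, conj_cnot, smul_mul_assoc]

theorem eqPhase_C {d : ℕ} (hd : 2 ≤ d) (φ : ℝ) :
    EqPhase d (CNOT ⨟ᶜ (P φ ⊗ᶜ wire) ⨟ᶜ CNOT) (P φ ⊗ᶜ wire) := by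
  refine ⟨Complex.I, pow_two_pow_mono hd (by norm_num), fun k => ?_⟩
  simp only [interp, mul_one, rz, site_diagonal, conj_cnot]
  congr 2
  funext x
  simp

theorem eqPhase_B {d : ℕ} (hd : 2 ≤ d) : EqPhase d (CNOT ⨟ᶜ NOTC) (swap ⨟ᶜ CNOT) := by
  refine ⟨Complex.I, pow_two_pow_mono hd (by norm_num), fun k => ?_⟩
  simp only [NOTC, interp, smul_mul_assoc, mul_smul_comm, smul_smul, pull_mul_pull]
  congr 1
  · rw [← eighthRoot_mul_self]; ring
  · congr 1
    funext x j
    have fact : ∀ a b : Fin 2, a + (b + a) = b := by decide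
    by_cases h : j = k
    · subst h; simp [add_comm]
    by_cases h' : j = k + 1
    · subst h'; simp [fact]
    simp [swapMap_of_ne h h', cnotMap_of_ne h']

theorem eighthRoot_ne_zero : eighthRoot ≠ 0 := Complex.exp_ne_zero _

theorem eighthRoot_pow_four : eighthRoot ^ 4 = -1 := by
  rw [show 4 = 2 * 2 by norm_num, pow_mul, eighthRoot_sq, Complex.I_sq]

theorem rz_pi_div_two : rz (Real.pi / 2) = Matrix.diagonal ![eighthRoot⁻¹, eighthRoot] := by
  rw [rz, eighthRoot, ← Complex.exp_neg, show Real.pi / 2 / 2 = Real.pi / 4 by ring, neg_mul]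

theorem rz_neg_pi_div_two :
    rz (-(Real.pi / 2)) = Matrix.diagonal ![eighthRoot, eighthRoot⁻¹] := by
  rw [rz, eighthRoot, ← Complex.exp_neg, show -(Real.pi / 2) / 2 = -(Real.pi / 4) by ring,
    Complex.ofReal_neg, neg_neg, neg_mul]

theorem fin_two_eq (a : Fin 2) : a = 0 ∨ a = 1 := by
  revert a; decide

theorem hadamard_cnot_hadamard (k : ℕ) :
    site (k + 1) hadamard * (pull (cnotMap k) * site (k + 1) hadamard) =
      (-1 : ℂ) • diag fun x => if x k = 1 ∧ x (k + 1) = 1 then -1 else 1 := by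
  have hu : ∀ x : Bits, ∀ a, x (k + 1) = a → update x (k + 1) a = x := by
    rintro x a rfl; exact update_eq_self _ _
  rw [hadamard, site_smul, mul_smul_comm, smul_mul_smul_comm, hadamard_scalar_sq]
  ext ψ : 1; funext x
  have hc' : ∀ b, cnotMap k (update x (k + 1) b) = update x (k + 1) (b + x k) := by
    intro b; simp [cnotMap]
  have h11 : (1 : Fin 2) + 1 = 0 := rfl
  simp only [LinearMap.smul_apply, Module.End.mul_apply, Pi.smul_apply, site_apply, pull_apply,
    diag_apply, hc', Fin.sum_univ_two, update_self, update_idem]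
  rcases fin_two_eq (x k) with h | h <;> rcases fin_two_eq (x (k + 1)) with h' | h' <;>
    simp [h, h', hu x _ h', h11] <;> ring

theorem eqPhase_CZ {d : ℕ} (hd : 1 ≤ d) : EqPhase d ((wire ⊗ᶜ H) ⨟ᶜ CNOT ⨟ᶜ (wire ⊗ᶜ H))
    ((P (Real.pi / 2) ⊗ᶜ P (Real.pi / 2)) ⨟ᶜ CNOT ⨟ᶜ (wire ⊗ᶜ P (-(Real.pi / 2))) ⨟ᶜ CNOT) := by
  refine ⟨-1, pow_two_pow_mono hd (by norm_num), fun k => ?_⟩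
  have h₀ := eighthRoot_ne_zero
  have h₄ := eighthRoot_pow_four
  simp only [interp, one_mul, rz_pi_div_two, rz_neg_pi_div_two, site_diagonal]
  rw [smul_mul_assoc, mul_smul_comm, hadamard_cnot_hadamard, ← mul_assoc (diag _), ← mul_assoc,
    conj_cnot, ← eighthRoot_mul_self, smul_comm]
  congr 1
  rw [smul_mul_assoc, diag_mul_diag, diag_mul_diag, mul_smul]
  congr 1
  ext ψ : 1; funext x
  simp only [LinearMap.smul_apply, Pi.smul_apply, diag_apply, Pi.mul_apply, comp_apply,
    cnotMap_right, smul_eq_mul, ← mul_assoc]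
  congr 1
  have h11 : (1 : Fin 2) + 1 = 0 := rfl
  rcases fin_two_eq (x k) with h | h <;> rcases fin_two_eq (x (k + 1)) with h' | h' <;>
    simp [h, h', h11] <;> field_simp
  -- The case where both bits are `1`: the phases multiply to `eighthRoot ^ 4 = -1`.
  linear_combination -h₄

/-! ### The equations with many controls -/

/-- The diagonal of the phase gate on the wire `o + k` controlled by the wires `o, …, o + k - 1`,
normalized to have determinant `1`. -/
noncomputable def ctrlPhase (k : ℕ) (φ : ℝ) (o : ℕ) (x : Bits) : ℂ :=
  Complex.exp (-(φ / 2 ^ (k + 1)) * Complex.I) *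
    if (∀ j < k, x (o + j) = 1) ∧ x (o + k) = 1 then Complex.exp (φ * Complex.I) else 1

/-- For bits `a`, `b` one has `a + b - (a ⊕ b) = 2ab`, so the half phases add up to `φ` exactly when
both are `1`. -/
theorem ctrlPhase_succ (k : ℕ) (φ : ℝ) (o : ℕ) :
    (ctrlPhase k (-(φ / 2)) o ∘ swapMap (o + k) ∘ cnotMap (o + k)) *
      ((ctrlPhase k (φ / 2) o ∘ swapMap (o + k)) * ctrlPhase k (φ / 2) o) =
      ctrlPhase (k + 1) φ o := by
  funext x
  have hs : ∀ y, (∀ j < k, swapMap (o + k) y (o + j) = 1) ↔ ∀ j < k, y (o + j) = 1 := fun y =>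
    forall₂_congr fun j hj => by rw [swapMap_of_ne (by omega) (by omega)]
  have hc : (∀ j < k, cnotMap (o + k) x (o + j) = 1) ↔ ∀ j < k, x (o + j) = 1 :=
    forall₂_congr fun j hj => by rw [cnotMap_of_ne (by omega)]
  have hsucc : (∀ j < k + 1, x (o + j) = 1) ↔ (∀ j < k, x (o + j) = 1) ∧ x (o + k) = 1 :=
    Nat.forall_lt_succ_right
  simp only [Pi.mul_apply, comp_apply, ctrlPhase, hs, hc, hsucc, swapMap_left, cnotMap_right,
    ← add_assoc]
  have h₁ : Complex.exp (-(((-(φ / 2) : ℝ) : ℂ) / 2 ^ (k + 1)) * Complex.I) *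
      (Complex.exp (-(((φ / 2 : ℝ) : ℂ) / 2 ^ (k + 1)) * Complex.I) *
        Complex.exp (-(((φ / 2 : ℝ) : ℂ) / 2 ^ (k + 1)) * Complex.I)) =
      Complex.exp (-((φ : ℂ) / 2 ^ (k + 1 + 1)) * Complex.I) := by
    rw [← Complex.exp_add, ← Complex.exp_add]
    congr 1
    push_cast
    field_simp
    ring
  have h₂ : Complex.exp (φ * Complex.I) =
      Complex.exp (((φ / 2 : ℝ) : ℂ) * Complex.I) * Complex.exp (((φ / 2 : ℝ) : ℂ) * Complex.I) := by
    rw [← Complex.exp_add]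
    congr 1
    push_cast
    ring
  have h₃ : Complex.exp (((-(φ / 2) : ℝ) : ℂ) * Complex.I) =
      (Complex.exp (((φ / 2 : ℝ) : ℂ) * Complex.I))⁻¹ := by
    rw [← Complex.exp_neg]
    congr 1
    push_cast
    ring
  rw [← h₁, h₂, h₃]
  have h₀ := Complex.exp_ne_zero (((φ / 2 : ℝ) : ℂ) * Complex.I)
  have h11 : (1 : Fin 2) + 1 = 0 := rfl
  generalize Complex.exp (((φ / 2 : ℝ) : ℂ) * Complex.I) = w at *
  generalize Complex.exp (-(((φ / 2 : ℝ) : ℂ) / 2 ^ (k + 1)) * Complex.I) = u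
  generalize Complex.exp (-(((-(φ / 2) : ℝ) : ℂ) / 2 ^ (k + 1)) * Complex.I) = v
  by_cases h : ∀ j < k, x (o + j) = 1
  · simp only [eq_true h, true_and]
    rcases fin_two_eq (x (o + k)) with ha | ha <;>
      rcases fin_two_eq (x (o + k + 1)) with hb | hb <;>
      simp [ha, hb, h11] <;> field_simp
  · simp only [eq_false h, false_and, if_false, mul_one]

/-- Each conjugation by a swap or `CNOT` contributes `i`. The induction needs `ε` independent of the
angle, since it is used at `φ / 2` and `-(φ / 2)`. -/
theorem interp_mctrlP (k : ℕ) : ∃ ε : ℂ, ε ^ 4 = 1 ∧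
    ∀ φ o, interp (mctrlP k φ) o = ε • diag (ctrlPhase k φ o) := by
  induction k with
  | zero =>
    refine ⟨1, one_pow _, fun φ o => ?_⟩
    rw [mctrlP, interp, rz, site_diagonal, one_smul]
    congr 1
    funext x
    rcases fin_two_eq (x o) with h | h
    · simp [ctrlPhase, h]
    · simp only [ctrlPhase, h, add_zero, not_lt_zero, IsEmpty.forall_iff, implies_true, and_self,
        if_true, ← Complex.exp_add, Matrix.cons_val_one, Matrix.cons_val_fin_one]
      congr 1
      push_cast
      ring
  | succ k ih =>
    obtain ⟨ε, hε, ih⟩ := ih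
    refine ⟨Complex.I * (Complex.I * ε) * ((Complex.I * ε) * ε), ?_, fun φ o => ?_⟩
    · linear_combination (Complex.I ^ 12 * ε ^ 8 + Complex.I ^ 12 * ε ^ 4 + Complex.I ^ 12) * hε +
        (Complex.I ^ 10 - Complex.I ^ 8 + Complex.I ^ 6 - Complex.I ^ 4 + Complex.I ^ 2 - 1) *
          Complex.I_sq
    · have hs : ∀ ψ, interp (onLastTwo k swap ⨟ᶜ onAllButLast k (mctrlP k ψ) ⨟ᶜ onLastTwo k swap) o
          = (Complex.I * ε) • diag (ctrlPhase k ψ o ∘ swapMap (o + k)) := by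
        intro ψ
        simp only [onLastTwo, onAllButLast, interp, interp_wires, one_mul, mul_one, ih]
        rw [smul_mul_assoc ε, mul_smul_comm ε, conj_swap, smul_smul, mul_comm]
      change interp (onLastTwo k CNOT) o *
        (interp (onLastTwo k swap ⨟ᶜ onAllButLast k (mctrlP k (-(φ / 2))) ⨟ᶜ onLastTwo k swap) o *
        (interp (onLastTwo k CNOT) o *
        (interp (onLastTwo k swap ⨟ᶜ onAllButLast k (mctrlP k (φ / 2)) ⨟ᶜ onLastTwo k swap) o *
        interp (onAllButLast k (mctrlP k (φ / 2))) o))) = _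
      rw [hs, hs]
      simp only [onLastTwo, onAllButLast, interp, interp_wires, one_mul, mul_one, ih]
      rw [smul_mul_assoc (Complex.I * ε), mul_smul_comm (Complex.I * ε), conj_cnot_mul,
        smul_mul_smul_comm, diag_mul_diag, mul_smul_comm, diag_mul_diag, comp_assoc,
        ctrlPhase_succ, smul_smul, smul_smul]
      congr 1
      ring

theorem ctrlPhase_two_pi (k o : ℕ) : ctrlPhase k (2 * Real.pi) o =
    fun _ => Complex.exp (-(((2 * Real.pi : ℝ) : ℂ) / 2 ^ (k + 1)) * Complex.I) := by
  funext x
  simp [ctrlPhase, Complex.exp_two_pi_mul_I]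

/-- At `2π` only the normalizing factor `exp (-2πi / 2 ^ (k + 1))` survives, and its `2 ^ k`-th
power is `-1`. The assumption `2 ≤ k` makes `ε ^ 2 ^ k = 1`. -/
theorem exists_interp_mctrlP_two_pi {k : ℕ} (hk : 2 ≤ k) : ∃ κ : ℂ, κ ^ 2 ^ k = -1 ∧
    ∀ o, interp (mctrlP k (2 * Real.pi)) o = κ • 1 := by
  obtain ⟨ε, hε, h⟩ := interp_mctrlP k
  refine ⟨ε * Complex.exp (-(((2 * Real.pi : ℝ) : ℂ) / 2 ^ (k + 1)) * Complex.I), ?_, fun o => ?_⟩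
  · rw [mul_pow, pow_two_pow_mono (d := 2) hk (by norm_num [hε]), one_mul, ← Complex.exp_nat_mul,
      ← inv_inj, ← Complex.exp_neg, inv_neg, inv_one, ← Complex.exp_pi_mul_I]
    congr 1
    push_cast
    field_simp
    ring
  · rw [h, ctrlPhase_two_pi, diag_const, smul_smul]

/-- The operators on circuits of width `n` are considered up to roots of unity of order dividing
`2 ^ phaseExponent c n`; the width `c + 1` is exceptional. -/
def phaseExponent (c n : ℕ) : ℕ := if n = c + 1 then c else n

theorem monotone_phaseExponent (c : ℕ) : Monotone (phaseExponent c) := by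
  intro n m h
  unfold phaseExponent
  split_ifs <;> omega

theorem not_derivable_I (c : ℕ) (hc : 2 ≤ c) :
    ¬ ∀ (n m : ℕ) (C D : Circuit n m), QCugp (.I c hc) n m C D →
      Derives (fun n m C' D' => ∃ b, b ≠ .I c hc ∧ QCugp b n m C' D') C D := by
  intro h
  have h₁ : 1 ≤ phaseExponent c 1 := by unfold phaseExponent; split_ifs <;> omega
  have h₂ : 2 ≤ phaseExponent c 2 := by unfold phaseExponent; split_ifs <;> omega
  have h₃ : phaseExponent c (c + 1) = c := if_pos rfl
  obtain ⟨κ, hκ, he⟩ := eqPhase_of_derives (monotone_phaseExponent c) h₂ (by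
    rintro n m C D ⟨b, hb, hCD⟩
    cases hCD with
    | HH => exact eqPhase_HH h₁
    | P0 => exact eqPhase_P0 _
    | C φ => exact eqPhase_C h₂ φ
    | B => exact eqPhase_B h₂
    | CZ => exact eqPhase_CZ (one_le_two.trans h₂)
    | EH => exact eqPhase_EH _
    | Euler α₁ α₂ α₃ => exact eqPhase_Euler h₁ α₁ α₂ α₃
    | I c' hc' =>
      obtain ⟨κ, hκ, he⟩ := exists_interp_mctrlP_two_pi hc'
      have hne : c' ≠ c := by rintro rfl; exact hb rfl
      refine ⟨κ, ?_, fun o => by rw [he, interp_wires]⟩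
      rw [phaseExponent, if_neg (by omega), pow_succ, pow_mul, hκ, neg_one_sq])
    (h _ _ _ _ (.I c hc))
  obtain ⟨κ', hκ', he'⟩ := exists_interp_mctrlP_two_pi hc
  have hκκ : κ' = κ := by
    -- Evaluating on the constant function `1` recovers the scalar.
    have := congrArg (fun A : Operator => A 1 0) ((he' 0).symm.trans (he 0))
    simpa using this
  rw [h₃, ← hκκ, hκ'] at hκ
  norm_num at hκ

end CircuitUGP

theorem mainTheorem10 : CircuitUGP.IsMinimal CircuitUGP.QCugp := by
  open CircuitUGP in
  rintro (_ | _ | _ | _ | _ | _ | _ | ⟨c, hc⟩)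
  exacts [not_derivable_HH, not_derivable_P0, not_derivable_C, not_derivable_B, not_derivable_CZ,
    not_derivable_EH, not_derivable_Euler, not_derivable_I c hc]
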